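/- **Proposition.** Let the activation be $\varphi_c(t)=(t)_+ + c\,(-t)_+$ with $c\in(-1,0]$ (the ReLU for $c=0$, a leaky ReLU for $c<0$). For $d\ge 1$ let $\tau=\mathrm{Unif}(\mathbb S^{d-1})\otimes\mathcal N(0,1)$ and let $\mathcal H$ be the reproducing kernel Hilbert space of functions $\mathbb R^d\to\mathbb R$ with kernel $$k(x,y)=\int_{\mathbb S^{d-1}\times\mathbb R}\varphi_c(\langle\theta,x\rangle-b)\,\varphi_c(\langle\theta,y\rangle-b)\,d\tau(\theta,b).$$ Let $\mathcal F_{\mathcal H}=\{f\in\mathcal H:\|f\|_{\mathcal H}\le 1\}$ and, for probability measures $\mu,\nu$ on $\mathbb R^d$, let $$d_{\mathcal F_{\mathcal H}}(\mu,\nu)=\sup_{f\in\mathcal F_{\mathcal H}}\big|\mathbb E_{x\sim\mu}f(x)-\mathbb E_{x\sim\nu}f(x)\big|,$$ where the difference of expectations is understood as the integral $\int f\,d(\mu-\nu)$ against the signed measure $\mu-\nu$. There is an absolute constant $C>0$ such that for all $d\ge1$, $\sigma>0$, $\ell\ge0$, $c\in(-1,0]$ and all probability measures $\mu_d,\nu_d$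 on $\mathbb R^d$ having Lebesgue densities whose difference is $$\rho_d(x)=\frac{2\sigma^d}{(2\pi)^{d/2}}\,e^{-\sigma^2\|x\|^2/2}\,\sin(\ell x_1),$$ every $f\in\mathcal F_{\mathcal H}$ is integrable with respect to $|\mu_d-\nu_d|$, and $$d_{\mathcal F_{\mathcal H}}(\mu_d,\nu_d)\le C\left(d^{1/4}\Big(2^{-d/4}+e^{-\frac{\ell^2}{4\sigma^2}}\Big)+\frac{\ell^2}{\sigma^4}e^{-\frac{(\ell-1)^2}{2\sigma^2}}+\Big(\frac{\ell}{\sigma^2}+1\Big)e^{-\frac{\ell^2}{2\sigma^2}}\right).$$ -/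

import Mathlib

open MeasureTheory ProbabilityTheory
open scoped ENNReal

namespace ReluMMD

noncomputable section

/-- The activation `t ↦ (t)₊ + c (-t)₊`: the ReLU for `c = 0`, a leaky ReLU for `-1 < c < 0`. -/
def act (c t : ℝ) : ℝ := max t 0 + c * max (-t) 0

/-- The uniform probability measure on the unit sphere of `ℝ^d`: the normalized surface measure. -/
def sphereUnif (d : ℕ) : Measure (Metric.sphere (0 : EuclideanSpace ℝ (Fin d)) 1) :=
  ((volume : Measure (EuclideanSpace ℝ (Fin d))).toSphere Set.univ)⁻¹ •
    (volume : Measure (EuclideanSpace ℝ (Fin d))).toSphere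

/-- The law `τ = Unif(S^{d-1}) ⊗ N(0,1)` of the random features `(θ, b)`. -/
def featureLaw (d : ℕ) : Measure (Metric.sphere (0 : EuclideanSpace ℝ (Fin d)) 1 × ℝ) :=
  (sphereUnif d).prod (gaussianReal 0 1)

/-- The value at `x` of the random feature with parameter `p = (θ, b)`, that is
`act c (⟪θ, x⟫ - b)`. -/
def feature (d : ℕ) (c : ℝ) (x : EuclideanSpace ℝ (Fin d))
    (p : Metric.sphere (0 : EuclideanSpace ℝ (Fin d)) 1 × ℝ) : ℝ :=
  act c (inner ℝ (p.1 : EuclideanSpace ℝ (Fin d)) x - p.2)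

/-- The kernel `k(x, y) = ∫ act c (⟪θ, x⟫ - b) * act c (⟪θ, y⟫ - b) dτ(θ, b)`. -/
def nnKernel (d : ℕ) (c : ℝ) (x y : EuclideanSpace ℝ (Fin d)) : ℝ :=
  ∫ p, feature d c x p * feature d c y p ∂(featureLaw d)

/-- The kernel `k` with each value `k(x, y)` read as the operator "multiplication by `k(x, y)`" on
`ℝ`, the form in which kernels of (vector-valued) reproducing kernel Hilbert spaces are given. -/
def kernelMatrix (d : ℕ) (c : ℝ) :
    Matrix (EuclideanSpace ℝ (Fin d)) (EuclideanSpace ℝ (Fin d)) (ℝ →L[ℝ] ℝ) :=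
  Matrix.of fun x y => nnKernel d c x y • ContinuousLinearMap.id ℝ ℝ

instance isFiniteMeasure_sphereUnif (d : ℕ) : IsFiniteMeasure (sphereUnif d) where
  measure_univ_lt_top := by
    rw [sphereUnif, Measure.smul_apply, smul_eq_mul]
    exact lt_of_le_of_lt (ENNReal.inv_mul_le_one _) ENNReal.one_lt_top

instance isFiniteMeasure_featureLaw (d : ℕ) : IsFiniteMeasure (featureLaw d) := by
  unfold featureLaw; infer_instance

lemma isProbabilityMeasure_sphereUnif (d : ℕ) [NeZero d] :
    IsProbabilityMeasure (sphereUnif d) where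
  measure_univ := by
    rw [sphereUnif, Measure.smul_apply, smul_eq_mul]
    refine ENNReal.inv_mul_cancel ?_ (measure_ne_top _ _)
    rw [Ne, Measure.measure_univ_eq_zero]
    exact Measure.toSphere_ne_zero _

lemma continuous_feature (d : ℕ) (c : ℝ) (x : EuclideanSpace ℝ (Fin d)) :
    Continuous (feature d c x) := by
  unfold feature act; fun_prop

lemma memLp_feature (d : ℕ) (c : ℝ) (x : EuclideanSpace ℝ (Fin d)) :
    MemLp (feature d c x) 2 (featureLaw d) := by
  have h1 : MemLp (fun p : Metric.sphere (0 : EuclideanSpace ℝ (Fin d)) 1 × ℝ => p.2) 2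
      (featureLaw d) :=
    (memLp_id_gaussianReal (μ := 0) (v := 1) 2).comp_snd (sphereUnif d)
  have h2 : MemLp (fun p : Metric.sphere (0 : EuclideanSpace ℝ (Fin d)) 1 × ℝ =>
      (1 + |c|) * (‖x‖ + ‖p.2‖)) 2 (featureLaw d) :=
    ((memLp_const ‖x‖).add h1.norm).const_mul _
  refine h2.mono' (continuous_feature d c x).aestronglyMeasurable (ae_of_all _ fun p => ?_)
  have hθ : ‖(p.1 : EuclideanSpace ℝ (Fin d))‖ = 1 := by simp
  have hi : |inner ℝ (p.1 : EuclideanSpace ℝ (Fin d)) x| ≤ ‖x‖ := by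
    simpa [hθ] using abs_real_inner_le_norm (p.1 : EuclideanSpace ℝ (Fin d)) x
  set t := inner ℝ (p.1 : EuclideanSpace ℝ (Fin d)) x - p.2 with ht
  have hta : |t| ≤ ‖x‖ + ‖p.2‖ := by
    rw [Real.norm_eq_abs p.2]; exact (abs_sub _ _).trans (by gcongr)
  have a1 : |max t 0| ≤ |t| := by
    rw [abs_of_nonneg (le_max_right _ _)]; exact max_le (le_abs_self _) (abs_nonneg _)
  have a2 : |max (-t) 0| ≤ |t| := by
    rw [abs_of_nonneg (le_max_right _ _)]; exact max_le (neg_le_abs _) (abs_nonneg _)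
  calc ‖feature d c x p‖ = |max t 0 + c * max (-t) 0| := rfl
    _ ≤ |max t 0| + |c| * |max (-t) 0| := by rw [← abs_mul]; exact abs_add_le _ _
    _ ≤ |t| + |c| * |t| := by gcongr
    _ = (1 + |c|) * |t| := by ring
    _ ≤ (1 + |c|) * (‖x‖ + ‖p.2‖) := by gcongr

lemma posSemidef_kernelMatrix (d : ℕ) (c : ℝ) : (kernelMatrix d c).PosSemidef := by
  have hsymm : ∀ x y, nnKernel d c x y = nnKernel d c y x := fun x y => by
    simp only [nnKernel, mul_comm]
  have htfae := (RKHS.posSemidef_tfae (K := kernelMatrix d c)).out 0 2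
  refine htfae.mpr ⟨?_, fun vv => ?_⟩
  · ext x y
    change star (nnKernel d c y x • (1 : ℝ →L[ℝ] ℝ)) 1 = (nnKernel d c x y • (1 : ℝ →L[ℝ] ℝ)) 1
    rw [star_smul, star_one, hsymm x y, star_trivial]
  · have key : (vv.sum fun x w => vv.sum fun x' w' =>
        inner ℝ (kernelMatrix d c x' x w) w') =
        ∫ p, (∑ x ∈ vv.support, vv x * feature d c x p) ^ 2 ∂(featureLaw d) := by
      have hint : ∀ x y, Integrable (fun p => feature d c x p * feature d c y p) (featureLaw d) :=
        fun x y => (memLp_feature d c x).integrable_mul (memLp_feature d c y)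
      have : ∀ p, (∑ x ∈ vv.support, vv x * feature d c x p) ^ 2 =
          ∑ x ∈ vv.support, ∑ y ∈ vv.support,
            (vv x * vv y) * (feature d c x p * feature d c y p) := fun p => by
        rw [sq, Finset.sum_mul_sum]
        exact Finset.sum_congr rfl fun x _ => Finset.sum_congr rfl fun y _ => by ring
      simp_rw [this]
      rw [integral_finsetSum _ fun x _ => integrable_finsetSum _ fun y _ =>
        (hint x y).const_mul _]
      refine Finset.sum_congr rfl fun x _ => ?_
      rw [integral_finsetSum _ fun y _ => (hint x y).const_mul _]
      refine Finset.sum_congr rfl fun y _ => ?_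
      rw [integral_const_mul]
      change inner ℝ (nnKernel d c y x • vv x) (vv y) = _
      rw [hsymm y x]
      simp [nnKernel]
      ring
    rw [key]
    exact integral_nonneg fun p => sq_nonneg _

instance fact_posSemidef_kernelMatrix (d : ℕ) (c : ℝ) : Fact (kernelMatrix d c).PosSemidef :=
  ⟨posSemidef_kernelMatrix d c⟩

/-- The class `F_H` of the functions on `ℝ^d` that lie in the closed unit ball of the reproducing
kernel Hilbert space `H` with kernel `k`. -/
def rkhsUnitBall (d : ℕ) (c : ℝ) : Set (EuclideanSpace ℝ (Fin d) → ℝ) :=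
  {f | ∃ g : RKHS.OfKernel (kernelMatrix d c), ‖g‖ ≤ 1 ∧ (⇑g : EuclideanSpace ℝ (Fin d) → ℝ) = f}

/-- The difference of expectations `E_μ f - E_ν f = ∫ f d(μ - ν)`, the integral of `f` against the
signed measure `μ - ν`. For measures, `μ - ν` below is the positive part and `ν - μ` is the negative
part of that signed measure, so nothing but integrability of `f` against the total variation of the
signed measure is needed; see `meanDiff_eq` for `f` with finite expectations. -/
def meanDiff {X : Type*} [MeasurableSpace X] (μ ν : Measure X) (f : X → ℝ) : ℝ :=
  ∫ x, f x ∂(μ - ν) - ∫ x, f x ∂(ν - μ)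

lemma meanDiff_eq {X : Type*} [MeasurableSpace X] (μ ν : Measure X) [IsFiniteMeasure μ]
    [IsFiniteMeasure ν] (f : X → ℝ) (hμ : Integrable f μ) (hν : Integrable f ν) :
    meanDiff μ ν f = ∫ x, f x ∂μ - ∫ x, f x ∂ν := by
  have h : (μ - ν) + ν = (ν - μ) + μ := by
    rw [← Measure.toSignedMeasure_eq_toSignedMeasure_iff, Measure.toSignedMeasure_add,
      Measure.toSignedMeasure_add]
    have := Measure.sub_toSignedMeasure_eq_toSignedMeasure_sub (μ := μ) (ν := ν)
    rw [sub_eq_sub_iff_add_eq_add] at this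
    rw [add_comm (ν - μ).toSignedMeasure, ← this, add_comm]
  have h1 : Integrable f (μ - ν) := hμ.mono_measure Measure.sub_le
  have h2 : Integrable f (ν - μ) := hν.mono_measure Measure.sub_le
  have := congrArg (fun m => ∫ x, f x ∂m) h
  simp only [integral_add_measure h1 hν, integral_add_measure h2 hμ] at this
  unfold meanDiff
  linarith

/-- The integral probability metric `d_F(μ, ν) = sup_{f ∈ F} |E_μ f - E_ν f|`, with values in
`[0, ∞]`. -/
def ipm {X : Type*} [MeasurableSpace X] (F : Set (X → ℝ)) (μ ν : Measure X) : ℝ≥0∞ :=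
  ⨆ f ∈ F, ENNReal.ofReal |meanDiff μ ν f|

/-- The function `ρ_d(x) = 2 σ^d (2π)^{-d/2} exp(-σ² ‖x‖² / 2) sin(ℓ x₁)`; the first coordinate
has index `0`. -/
def rho (d : ℕ) [NeZero d] (σ ℓ : ℝ) (x : EuclideanSpace ℝ (Fin d)) : ℝ :=
  2 * σ ^ d / (2 * Real.pi) ^ ((d : ℝ) / 2) * Real.exp (-(σ ^ 2 * ‖x‖ ^ 2) / 2) *
    Real.sin (ℓ * x 0)

/-- `μ` and `ν` are probability measures on `ℝ^d` with Lebesgue densities `p` and `q` whose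
difference is `ρ_d`. -/
def IsPair (d : ℕ) [NeZero d] (σ ℓ : ℝ) (μ ν : Measure (EuclideanSpace ℝ (Fin d))) : Prop :=
  IsProbabilityMeasure μ ∧ IsProbabilityMeasure ν ∧
    ∃ p q : EuclideanSpace ℝ (Fin d) → ℝ, Measurable p ∧ Measurable q ∧
      (∀ x, 0 ≤ p x) ∧ (∀ x, 0 ≤ q x) ∧
      μ = volume.withDensity (fun x => ENNReal.ofReal (p x)) ∧
      ν = volume.withDensity (fun x => ENNReal.ofReal (q x)) ∧
      ∀ᵐ x, p x - q x = rho d σ ℓ x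

end

end ReluMMD

/-! Write `γ = N(0, σ⁻² I)`. The density difference is `2 sin(ℓ x₁)` times the density of `γ`, so
the mean difference of `f` is `2 ∫ sin(ℓ x₁) f dγ` (`IsPair.meanDiff_eq`). By the reproducing
property this integral is `⟪f, v⟫`, where `v` is the Bochner integral of `sin(ℓ x₁)` times the
kernel section at `x`. Fubini gives `‖v‖² = ∫ G² dτ`, where `G(θ, b)` is the integral of the feature
against `sin(ℓ x₁) dγ` (`sq_integral_rkhs_mul_le`).

To bound `G`, split the activation into multiples of `|t|` and `t`. The linear part is computed
exactly and has size at most `B = (ℓ/σ²) exp(-ℓ²/(2σ²))`. In the other part, `|t|` is even and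
integrates to zero against the sine, so only `|t - b| - |t|` remains, which is bounded by `|b|`. The
component of `e₁` orthogonal to `θ` gives an independent Gaussian phase, whose characteristic
function supplies the factor `exp(-ℓ²(1 - ⟪θ, e₁⟫²)/(2σ²))` (`abs_integral_act_mul_sin_le`).

This factor is small unless `θ` lies near `±e₁`. The caps of angle `π/4` there have measure at most
`2 · 2^(-d/2)`, and outside them `1 - ⟪θ, e₁⟫² ≥ 1/2` (`integral_exp_sphereUnif_le`). Taking the
square root yields `2^(-d/4) + exp(-ℓ²/(4σ²)) + B` up to a constant, which is stronger than the
stated bound. -/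

namespace ReluMMD

/-! ### Spherical caps and a Laplace-type integral over the sphere. -/

open Metric Set Module
open scoped Pointwise RealInnerProductSpace

/-- The truncated cone over the spherical cap of angle `π / 4` around `e` lies in the ball with
diameter `[0, √2 e]`. -/
lemma smul_cap_subset_closedBall {E : Type*} [NormedAddCommGroup E] [InnerProductSpace ℝ E]
    {e : E} (he : ‖e‖ = 1) :
    Ioo (0 : ℝ) 1 • ((↑) '' {θ : sphere (0 : E) 1 | √2 / 2 ≤ ⟪(θ : E), e⟫}) ⊆
      closedBall ((√2 / 2) • e) (√2 / 2) := by
  rintro _ ⟨r, ⟨hr0, hr1⟩, _, ⟨θ, hθ, rfl⟩, rfl⟩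
  have hθn : ‖(θ : E)‖ = 1 := by simp
  have h2 : √2 * √2 = 2 := Real.mul_self_sqrt (by norm_num)
  have h0 : 0 ≤ √2 := Real.sqrt_nonneg 2
  simp only [mem_ofPred_eq] at hθ
  rw [mem_closedBall, dist_eq_norm]
  refine le_of_sq_le_sq ?_ (by positivity)
  change ‖r • (θ : E) - _‖ ^ 2 ≤ _
  rw [norm_sub_sq_real, norm_smul, norm_smul, inner_smul_left, inner_smul_right, hθn, he]
  simp only [Real.norm_eq_abs, mul_one, sq_abs, conj_trivial]
  -- The squared distance is `r² - √2 r ⟪θ, e⟫ + 1/2`, which is at most `1/2` because `r ≤ 1 ≤ √2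
  -- ⟪θ, e⟫`.
  have h3 : √2 / 2 * (√2 / 2) ≤ √2 / 2 * ⟪(θ : E), e⟫ := by gcongr
  have h4 : r * (√2 / 2 * (√2 / 2)) ≤ r * (√2 / 2 * ⟪(θ : E), e⟫) := by gcongr
  nlinarith

lemma sphereUnif_cap_le (d : ℕ) [NeZero d] {e : EuclideanSpace ℝ (Fin d)} (he : ‖e‖ = 1) :
    (sphereUnif d).real {θ | √2 / 2 ≤ ⟪(θ : EuclideanSpace ℝ (Fin d)), e⟫} ≤ (√2 / 2) ^ d := by
  have hs : MeasurableSet {θ : sphere (0 : EuclideanSpace ℝ (Fin d)) 1 |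
      √2 / 2 ≤ ⟪(θ : EuclideanSpace ℝ (Fin d)), e⟫} :=
    measurableSet_le measurable_const (by fun_prop)
  have hd : (d : ℝ≥0∞) ≠ 0 := by simpa using NeZero.ne d
  have hb : volume (ball (0 : EuclideanSpace ℝ (Fin d)) 1) ≠ 0 :=
    (measure_ball_pos _ _ one_pos).ne'
  have hb' : volume (ball (0 : EuclideanSpace ℝ (Fin d)) 1) ≠ ∞ := measure_ball_lt_top.ne
  refine ENNReal.toReal_le_of_le_ofReal (by positivity) ?_
  -- `toSphere` is `d` times the volume of the truncated cone over the set, so the normalized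
  -- measure of the cap is the volume of its cone divided by that of the unit ball.
  rw [sphereUnif, Measure.smul_apply, smul_eq_mul, Measure.toSphere_apply' _ hs,
    Measure.toSphere_apply_univ, finrank_euclideanSpace_fin, mul_comm, ← div_eq_mul_inv]
  refine ENNReal.div_le_of_le_mul ?_
  calc (d : ℝ≥0∞) * volume (Ioo (0 : ℝ) 1 • _)
      ≤ d * volume (closedBall ((√2 / 2) • e) (√2 / 2)) := by
        gcongr; exact smul_cap_subset_closedBall he
    _ = d * (ENNReal.ofReal ((√2 / 2) ^ d) * volume (ball (0 : EuclideanSpace ℝ (Fin d)) 1)) := by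
        rw [Measure.addHaar_closedBall _ _ (by positivity), finrank_euclideanSpace_fin]
    _ = _ := by ring

/-- A Laplace-type integral over the sphere is small outside the caps of angle `π / 4` around
`± e`, and these caps have small measure. -/
lemma integral_exp_sphereUnif_le (d : ℕ) [NeZero d] {e : EuclideanSpace ℝ (Fin d)} (he : ‖e‖ = 1)
    {a : ℝ} (ha : 0 ≤ a) :
    ∫ θ, Real.exp (-(a * (1 - ⟪(θ : EuclideanSpace ℝ (Fin d)), e⟫ ^ 2))) ∂(sphereUnif d) ≤
      Real.exp (-(a / 2)) + 2 * (√2 / 2) ^ d := by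
  have := isProbabilityMeasure_sphereUnif d
  have hmeas (u : EuclideanSpace ℝ (Fin d)) :
      MeasurableSet {θ : sphere (0 : EuclideanSpace ℝ (Fin d)) 1 |
      √2 / 2 ≤ ⟪(θ : EuclideanSpace ℝ (Fin d)), u⟫} :=
    measurableSet_le measurable_const (by fun_prop)
  set S := fun u : EuclideanSpace ℝ (Fin d) => {θ : sphere (0 : EuclideanSpace ℝ (Fin d)) 1 |
      √2 / 2 ≤ ⟪(θ : EuclideanSpace ℝ (Fin d)), u⟫} with hS
  have hle (θ : sphere (0 : EuclideanSpace ℝ (Fin d)) 1) :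
      ⟪(θ : EuclideanSpace ℝ (Fin d)), e⟫ ^ 2 ≤ 1 := by
    have := abs_real_inner_le_norm (θ : EuclideanSpace ℝ (Fin d)) e
    rw [he, norm_eq_of_mem_sphere, mul_one] at this
    rw [← sq_abs]; exact pow_le_one₀ (abs_nonneg _) this
  have hpt (θ : sphere (0 : EuclideanSpace ℝ (Fin d)) 1) :
      Real.exp (-(a * (1 - ⟪(θ : EuclideanSpace ℝ (Fin d)), e⟫ ^ 2))) ≤
        Real.exp (-(a / 2)) + ((S e).indicator 1 θ + (S (-e)).indicator 1 θ) := by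
    -- If `⟪θ, e⟫² ≥ 1/2`, then `θ` lies in one of the two caps and the integrand is at most 1;
    -- otherwise the exponent is below `-a/2`.
    by_cases h : 1 / 2 ≤ ⟪(θ : EuclideanSpace ℝ (Fin d)), e⟫ ^ 2
    · have h1 : Real.exp (-(a * (1 - ⟪(θ : EuclideanSpace ℝ (Fin d)), e⟫ ^ 2))) ≤ 1 := by
        rw [Real.exp_le_one_iff]
        nlinarith [hle θ]
      have h2 : (√2 / 2) ^ 2 ≤ ⟪(θ : EuclideanSpace ℝ (Fin d)), e⟫ ^ 2 := by
        rw [div_pow, Real.sq_sqrt (by norm_num)]; linarith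
      have h3 : √2 / 2 ≤ |⟪(θ : EuclideanSpace ℝ (Fin d)), e⟫| := by
        exact (le_abs_self _).trans (sq_le_sq.1 h2)
      have h4 : (1 : ℝ) ≤ (S e).indicator 1 θ + (S (-e)).indicator 1 θ := by
        have hn (u) : (0 : ℝ) ≤ (S u).indicator 1 θ := indicator_nonneg (by simp) _
        rcases le_abs'.1 h3 with h | h
        · have : θ ∈ S (-e) := by
            simp only [hS, mem_ofPred_eq, inner_neg_right]; linarith
          rw [indicator_of_mem this]
          simpa using hn e
        · have : θ ∈ S e := h
          rw [indicator_of_mem this]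
          simpa using hn (-e)
      linarith [Real.exp_pos (-(a / 2))]
    · have h1 : (0 : ℝ) ≤ (S e).indicator 1 θ + (S (-e)).indicator 1 θ :=
        add_nonneg (indicator_nonneg (by simp) _) (indicator_nonneg (by simp) _)
      have h2 : Real.exp (-(a * (1 - ⟪(θ : EuclideanSpace ℝ (Fin d)), e⟫ ^ 2))) ≤
          Real.exp (-(a / 2)) := by
        rw [Real.exp_le_exp]
        nlinarith
      linarith
  have hi (u) : Integrable ((S u).indicator (1 : sphere (0 : EuclideanSpace ℝ (Fin d)) 1 → ℝ)) (sphereUnif d) :=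
    (integrable_const (1 : ℝ)).indicator (hmeas u)
  have hadd : Integrable (fun θ => (S e).indicator (1 : sphere (0 : EuclideanSpace ℝ (Fin d)) 1 → ℝ) θ +
      (S (-e)).indicator 1 θ)
      (sphereUnif d) := (hi e).add (hi (-e))
  have hcap1 := sphereUnif_cap_le d he
  have hcap2 := sphereUnif_cap_le d (e := -e) (by simpa using he)
  calc _ ≤ ∫ θ, (Real.exp (-(a / 2)) + ((S e).indicator 1 θ + (S (-e)).indicator 1 θ))
          ∂(sphereUnif d) := by
        refine integral_mono_of_nonneg (ae_of_all _ fun θ => (Real.exp_pos _).le) ?_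
          (ae_of_all _ hpt)
        exact (integrable_const _).add hadd
    _ = Real.exp (-(a / 2)) + ((sphereUnif d).real (S e) + (sphereUnif d).real (S (-e))) := by
        rw [integral_add (integrable_const _) hadd,
          integral_add (hi e) (hi (-e)), integral_indicator_one (hmeas e),
          integral_indicator_one (hmeas (-e)), integral_const, probReal_univ, one_smul]
    _ ≤ _ := by linarith

end ReluMMD

/-! ### The isotropic Gaussian law, studied through its characteristic function. -/

namespace ReluMMD

open Complex
open scoped RealInnerProductSpace

/-- The density of the centered Gaussian law on `ℝ^d` with covariance `σ⁻² I`. -/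
noncomputable def isoGaussianPDF (d : ℕ) (σ : ℝ) (x : EuclideanSpace ℝ (Fin d)) : ℝ :=
  σ ^ d / (2 * Real.pi) ^ ((d : ℝ) / 2) * Real.exp (-(σ ^ 2 * ‖x‖ ^ 2) / 2)

/-- The centered Gaussian law on `ℝ^d` with covariance `σ⁻² I`. -/
noncomputable def isoGaussian (d : ℕ) (σ : ℝ) : Measure (EuclideanSpace ℝ (Fin d)) :=
  volume.withDensity fun x => ENNReal.ofReal (isoGaussianPDF d σ x)

variable {d : ℕ} {σ : ℝ}

lemma isoGaussianPDF_nonneg (hσ : 0 < σ) (x : EuclideanSpace ℝ (Fin d)) :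
    0 ≤ isoGaussianPDF d σ x := by
  unfold isoGaussianPDF; positivity

@[fun_prop]
lemma continuous_isoGaussianPDF (d : ℕ) (σ : ℝ) : Continuous (isoGaussianPDF d σ) := by
  unfold isoGaussianPDF; fun_prop

lemma integral_isoGaussian {F : Type*} [NormedAddCommGroup F] [NormedSpace ℝ F] (hσ : 0 < σ)
    (f : EuclideanSpace ℝ (Fin d) → F) :
    ∫ x, f x ∂(isoGaussian d σ) = ∫ x, isoGaussianPDF d σ x • f x := by
  rw [isoGaussian, integral_withDensity_eq_integral_toReal_smul (by fun_prop) (by simp)]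
  simp [ENNReal.toReal_ofReal (isoGaussianPDF_nonneg hσ _)]

lemma charFun_isoGaussian (hσ : 0 < σ) (t : EuclideanSpace ℝ (Fin d)) :
    charFun (isoGaussian d σ) t = cexp (-(‖t‖ ^ 2 / (2 * σ ^ 2) : ℝ)) := by
  have hσ' : (σ : ℂ) ≠ 0 := by exact_mod_cast hσ.ne'
  have hb : 0 < ((σ ^ 2 / 2 : ℝ) : ℂ).re := by rw [ofReal_re]; positivity
  have hG := GaussianFourier.integral_cexp_neg_mul_sq_norm_add hb I t
  -- The normalizing constant is the inverse of the Gaussian integral `(π / (σ²/2))^(d/2)`.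
  have hK : ((σ ^ d / (2 * Real.pi) ^ ((d : ℝ) / 2) : ℝ) : ℂ) *
      (Real.pi / ((σ ^ 2 / 2 : ℝ) : ℂ)) ^ (Module.finrank ℝ (EuclideanSpace ℝ (Fin d)) / 2 : ℂ)
        = 1 := by
    have h1 : (Real.pi / ((σ ^ 2 / 2 : ℝ) : ℂ)) ^
        (Module.finrank ℝ (EuclideanSpace ℝ (Fin d)) / 2 : ℂ) =
        (((2 * Real.pi) ^ ((d : ℝ) / 2) / σ ^ d : ℝ) : ℂ) := by
      rw [finrank_euclideanSpace_fin]
      have : (Real.pi / ((σ ^ 2 / 2 : ℝ) : ℂ)) = ((2 * Real.pi / σ ^ 2 : ℝ) : ℂ) := by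
        push_cast; field_simp
      rw [this, show ((d : ℂ) / 2) = (((d : ℝ) / 2 : ℝ) : ℂ) by push_cast; rfl,
        ← ofReal_cpow (by positivity), Real.div_rpow (by positivity) (by positivity),
        ← Real.rpow_natCast σ 2, ← Real.rpow_mul hσ.le, ← Real.rpow_natCast σ d]
      congr 3
      push_cast; ring_nf
    rw [h1, ← ofReal_mul]
    norm_cast
    have : (2 * Real.pi) ^ ((d : ℝ) / 2) ≠ 0 := by positivity
    field_simp
  rw [charFun_apply, integral_isoGaussian hσ]
  calc ∫ x, isoGaussianPDF d σ x • cexp (⟪x, t⟫ * I)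
      = ∫ x, ((σ ^ d / (2 * Real.pi) ^ ((d : ℝ) / 2) : ℝ) : ℂ) *
          cexp (-((σ ^ 2 / 2 : ℝ) : ℂ) * ‖x‖ ^ 2 + I * ⟪t, x⟫) := by
        refine integral_congr_ae (ae_of_all _ fun x => ?_)
        simp only [isoGaussianPDF, real_smul]
        rw [ofReal_mul, mul_assoc, ofReal_exp, ← Complex.exp_add, real_inner_comm]
        push_cast
        ring_nf
    _ = _ := by
        rw [integral_const_mul, hG, ← mul_assoc, hK, one_mul, I_sq]
        congr 1
        push_cast
        field_simp
        ring

/-- The total mass is the characteristic function at `0`. -/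
lemma isProbabilityMeasure_isoGaussian (d : ℕ) (hσ : 0 < σ) :
    IsProbabilityMeasure (isoGaussian d σ) := by
  have h := charFun_isoGaussian (d := d) hσ 0
  rw [charFun_zero] at h
  simp only [norm_zero, ne_eq, OfNat.ofNat_ne_zero, not_false_eq_true, zero_pow, zero_div,
    ofReal_zero, neg_zero, Complex.exp_zero] at h
  have h' : (isoGaussian d σ).real Set.univ = 1 := by exact_mod_cast h
  exact ⟨(ENNReal.toReal_eq_one_iff _).1 h'⟩

lemma map_inner_isoGaussian (hσ : 0 < σ) (u : EuclideanSpace ℝ (Fin d)) :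
    (isoGaussian d σ).map (fun x => ⟪u, x⟫) = gaussianReal 0 (‖u‖₊ ^ 2 / σ.toNNReal ^ 2) := by
  have := isProbabilityMeasure_isoGaussian d hσ
  refine Measure.ext_of_charFun (funext fun t => ?_)
  rw [charFun_gaussianReal, charFun_apply_real, integral_map (by fun_prop) (by fun_prop)]
  have h := charFun_isoGaussian hσ (t • u)
  rw [charFun_apply] at h
  simp only [inner_smul_right] at h
  calc _ = ∫ x, cexp (((t * ⟪x, u⟫ : ℝ) : ℂ) * I) ∂(isoGaussian d σ) := by
        simp [real_inner_comm]
    _ = _ := by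
        rw [h, norm_smul]
        congr 1
        push_cast [Real.coe_toNNReal _ hσ.le]
        simp only [Real.norm_eq_abs]
        rw [mul_pow, ← ofReal_pow, sq_abs]
        push_cast
        field_simp
        ring

/-- By Pythagoras `‖s u + t v‖² = s²‖u‖² + t²‖v‖²`, so the joint characteristic function factors. -/
lemma indepFun_inner_isoGaussian (hσ : 0 < σ) {u v : EuclideanSpace ℝ (Fin d)} (huv : ⟪u, v⟫ = 0) :
    IndepFun (fun x => ⟪u, x⟫) (fun x => ⟪v, x⟫) (isoGaussian d σ) := by
  have := isProbabilityMeasure_isoGaussian d hσ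
  rw [indepFun_iff_charFun_prod (by fun_prop) (by fun_prop)]
  intro t
  have hmap (w : EuclideanSpace ℝ (Fin d)) (s : ℝ) :
      charFun ((isoGaussian d σ).map fun x => ⟪w, x⟫) s = charFun (isoGaussian d σ) (s • w) := by
    rw [charFun_apply_real, integral_map (by fun_prop) (by fun_prop), charFun_apply]
    simp [inner_smul_right, real_inner_comm]
  have h2 : charFun ((isoGaussian d σ).map fun x => WithLp.toLp 2 (⟪u, x⟫, ⟪v, x⟫)) t =
      charFun (isoGaussian d σ) (t.ofLp.1 • u + t.ofLp.2 • v) := by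
    rw [charFun_apply, integral_map (by fun_prop) (by fun_prop), charFun_apply]
    simp [inner_smul_right, inner_add_right, real_inner_comm, WithLp.prod_inner_apply, mul_comm]
  rw [hmap, hmap, h2, charFun_isoGaussian hσ, charFun_isoGaussian hσ, charFun_isoGaussian hσ,
    ← Complex.exp_add, norm_add_sq_real, inner_smul_left, inner_smul_right, huv]
  congr 1
  push_cast
  simp
  ring

lemma isNegInvariant_isoGaussian (hσ : 0 < σ) : (isoGaussian d σ).IsNegInvariant := by
  have := isProbabilityMeasure_isoGaussian d hσ
  refine ⟨?_⟩
  rw [Measure.neg]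
  refine Measure.ext_of_charFun (funext fun t => ?_)
  rw [charFun_apply, integral_map (by fun_prop) (by fun_prop)]
  have : ∫ x, cexp (⟪-x, t⟫ * I) ∂(isoGaussian d σ) = charFun (isoGaussian d σ) (-t) := by
    rw [charFun_apply]; simp
  change ∫ x, cexp (⟪-x, t⟫ * I) ∂(isoGaussian d σ) = _
  rw [this, charFun_isoGaussian hσ, charFun_isoGaussian hσ, norm_neg]

lemma integrable_inner_isoGaussian (hσ : 0 < σ) (u : EuclideanSpace ℝ (Fin d)) :
    Integrable (fun x => ⟪u, x⟫) (isoGaussian d σ) := by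
  have h : Integrable id ((isoGaussian d σ).map (fun x => ⟪u, x⟫)) := by
    rw [map_inner_isoGaussian hσ]
    exact memLp_one_iff_integrable.1 (memLp_id_gaussianReal 1)
  exact h.comp_measurable (by fun_prop)

/-- Features and RKHS functions grow at most linearly, so a finite first moment is all that the
integrability arguments need from the Gaussian. -/
lemma integrable_norm_isoGaussian (hσ : 0 < σ) :
    Integrable (fun x => ‖x‖) (isoGaussian d σ) := by
  have h : Integrable (fun x : EuclideanSpace ℝ (Fin d) =>
      ∑ i, |⟪EuclideanSpace.single i (1 : ℝ), x⟫|) (isoGaussian d σ) :=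
    integrable_finsetSum _ fun i _ => (integrable_inner_isoGaussian hσ _).abs
  refine h.mono' (by fun_prop) (ae_of_all _ fun x => ?_)
  rw [norm_norm]
  calc ‖x‖ = ‖∑ i, x i • EuclideanSpace.single i (1 : ℝ)‖ := by
        congr 1
        have := (EuclideanSpace.basisFun (Fin d) ℝ).sum_repr x
        simpa using this.symm
    _ ≤ ∑ i, ‖x i • EuclideanSpace.single i (1 : ℝ)‖ := norm_sum_le _ _
    _ = _ := by simp [norm_smul, EuclideanSpace.inner_single_left]

end ReluMMD

/-! ### Oscillatory Gaussian integrals of a single neuron. -/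

namespace ReluMMD

open Complex
open scoped RealInnerProductSpace

/-- No smoothness of `g` is needed: the decay comes only from the part of `e` orthogonal to `θ`, on
which `g ⟪θ, x⟫` does not depend. -/
lemma abs_integral_comp_inner_mul_sin_le {d : ℕ} {σ : ℝ} (hσ : 0 < σ)
    {θ e : EuclideanSpace ℝ (Fin d)} (hθ : ‖θ‖ = 1) (he : ‖e‖ = 1) (ℓ : ℝ) {g : ℝ → ℝ} {M : ℝ}
    (hg : Measurable g) (hM : ∀ t, |g t| ≤ M) :
    |∫ x, g ⟪θ, x⟫ * Real.sin (ℓ * ⟪e, x⟫) ∂(isoGaussian d σ)| ≤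
      M * Real.exp (-(ℓ ^ 2 * (1 - ⟪θ, e⟫ ^ 2) / (2 * σ ^ 2))) := by
  have := isProbabilityMeasure_isoGaussian d hσ
  have hM0 : 0 ≤ M := (abs_nonneg _).trans (hM 0)
  set a := ⟪θ, e⟫ with ha
  set u := e - a • θ with hu
  have hθu : ⟪θ, u⟫ = 0 := by
    rw [hu, inner_sub_right, inner_smul_right, real_inner_self_eq_norm_sq, hθ]
    simp [ha]
  have hun : ‖u‖ ^ 2 = 1 - a ^ 2 := by
    rw [hu, norm_sub_sq_real, norm_smul, inner_smul_right, hθ, he, real_inner_comm θ e, ← ha]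
    simp; ring
  have hex (x) : ⟪e, x⟫ = a * ⟪θ, x⟫ + ⟪u, x⟫ := by
    rw [hu, inner_sub_left, inner_smul_left]; simp
  -- The sine is replaced by the imaginary part of a complex exponential, which splits into a factor
  -- in `⟪θ, x⟫` and an independent factor in `⟪u, x⟫`.
  have hind : IndepFun (fun x => (g ⟪θ, x⟫ : ℂ) * cexp ((ℓ * (a * ⟪θ, x⟫) : ℝ) * I))
      (fun x => cexp ((ℓ * ⟪u, x⟫ : ℝ) * I)) (isoGaussian d σ) :=
    (indepFun_inner_isoGaussian hσ hθu).comp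
      (φ := fun t : ℝ => (g t : ℂ) * cexp ((ℓ * (a * t) : ℝ) * I))
      (ψ := fun t : ℝ => cexp ((ℓ * t : ℝ) * I)) (by fun_prop) (by fun_prop)
  have hprod := hind.integral_fun_mul_eq_mul_integral
    (Measurable.aestronglyMeasurable (by fun_prop)) (Measurable.aestronglyMeasurable (by fun_prop))
  have hchar : ∫ x, cexp ((ℓ * ⟪u, x⟫ : ℝ) * I) ∂(isoGaussian d σ) =
      Real.exp (-(ℓ ^ 2 * (1 - a ^ 2) / (2 * σ ^ 2))) := by
    have h := charFun_isoGaussian hσ (ℓ • u)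
    rw [charFun_apply] at h
    simp only [inner_smul_right] at h
    simp_rw [real_inner_comm _ u]
    rw [h, norm_smul, mul_pow, hun, Real.norm_eq_abs, sq_abs]
    push_cast; rfl
  have hfun (x) : (g ⟪θ, x⟫ : ℂ) * cexp ((ℓ * (a * ⟪θ, x⟫) : ℝ) * I) *
      cexp ((ℓ * ⟪u, x⟫ : ℝ) * I) = (g ⟪θ, x⟫ : ℂ) * cexp ((ℓ * ⟪e, x⟫ : ℝ) * I) := by
    rw [mul_assoc, ← Complex.exp_add, hex x]
    push_cast; ring_nf
  have hint : Integrable (fun x => (g ⟪θ, x⟫ : ℂ) * cexp ((ℓ * ⟪e, x⟫ : ℝ) * I))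
      (isoGaussian d σ) := by
    refine (integrable_const M).mono' (Measurable.aestronglyMeasurable (by fun_prop))
      (ae_of_all _ fun x => ?_)
    rw [norm_mul, norm_exp_ofReal_mul_I, mul_one, norm_real]
    exact hM _
  have him : ∫ x, g ⟪θ, x⟫ * Real.sin (ℓ * ⟪e, x⟫) ∂(isoGaussian d σ) =
      (∫ x, (g ⟪θ, x⟫ : ℂ) * cexp ((ℓ * ⟪e, x⟫ : ℝ) * I) ∂(isoGaussian d σ)).im := by
    have h := integral_im hint
    simp only [RCLike.im_to_complex] at h
    rw [← h]
    refine integral_congr_ae (ae_of_all _ fun x => ?_)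
    simp only [im_ofReal_mul, exp_ofReal_mul_I_im]
  rw [him]
  refine (abs_im_le_norm _).trans ?_
  simp_rw [hfun] at hprod
  rw [hprod, hchar, norm_mul, norm_real, Real.norm_eq_abs, Real.abs_exp]
  gcongr
  refine (norm_integral_le_of_norm_le_const (C := M) (ae_of_all _ fun x => ?_)).trans (by simp)
  rw [norm_mul, norm_exp_ofReal_mul_I, mul_one, norm_real]
  exact hM _

/-- The derivative of the complex moment generating function at `iℓ` is `E[X exp(iℓX)]`; comparing
it with the explicit formula and taking imaginary parts gives the value. -/
lemma integral_mul_sin_gaussianReal (v : NNReal) (ℓ : ℝ) :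
    ∫ t, t * Real.sin (ℓ * t) ∂(gaussianReal 0 v) = v * ℓ * Real.exp (-(v * ℓ ^ 2 / 2)) := by
  have hd := hasDerivAt_complexMGF (X := id) (μ := gaussianReal 0 v) (z := ℓ * I)
    (by rw [integrableExpSet_id_gaussianReal]; simp)
  have hd' : HasDerivAt (complexMGF id (gaussianReal 0 v))
      (cexp (v * (ℓ * I) ^ 2 / 2) * (v * (ℓ * I))) (ℓ * I) := by
    have h : complexMGF id (gaussianReal 0 v) = fun z => cexp (v * z ^ 2 / 2) := by
      ext z; rw [complexMGF_id_gaussianReal]; simp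
    rw [h]
    have h2 : HasDerivAt (fun z : ℂ => v * z ^ 2 / 2) (v * (ℓ * I)) (ℓ * I) := by
      refine ((((hasDerivAt_id (ℓ * I : ℂ)).pow 2).const_mul (v : ℂ)).div_const 2).congr_deriv ?_
      simp only [id_eq]
      push_cast
      ring
    exact h2.cexp
  have heq := hd.unique hd'
  have hint : Integrable (fun t : ℝ => (t : ℂ) * cexp (ℓ * I * t)) (gaussianReal 0 v) := by
    have h1 : Integrable id (gaussianReal 0 v) :=
      memLp_one_iff_integrable.1 (memLp_id_gaussianReal 1)
    refine h1.norm.mono' (by fun_prop) (ae_of_all _ fun t => ?_)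
    rw [norm_mul, show (ℓ * I * t : ℂ) = ((ℓ * t : ℝ) : ℂ) * I by push_cast; ring,
      norm_exp_ofReal_mul_I, mul_one, norm_real]
    rfl
  have h := integral_im hint
  simp only [RCLike.im_to_complex] at h
  simp only [id_eq] at heq
  rw [heq] at h
  have e1 : cexp (v * (ℓ * I) ^ 2 / 2) * (v * (ℓ * I)) =
      ((v * ℓ * Real.exp (-(v * ℓ ^ 2 / 2)) : ℝ) : ℂ) * I := by
    push_cast
    rw [mul_pow, I_sq]
    ring_nf
  rw [e1, im_ofReal_mul, I_im, mul_one] at h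
  rw [← h]
  refine integral_congr_ae (ae_of_all _ fun t => ?_)
  simp only [im_ofReal_mul]
  rw [show (ℓ * I * t : ℂ) = ((ℓ * t : ℝ) : ℂ) * I by push_cast; ring, exp_ofReal_mul_I_im]

lemma integrable_inner_mul_sin_isoGaussian {d : ℕ} {σ : ℝ} (hσ : 0 < σ)
    (u e : EuclideanSpace ℝ (Fin d)) (ℓ : ℝ) :
    Integrable (fun x => ⟪u, x⟫ * Real.sin (ℓ * ⟪e, x⟫)) (isoGaussian d σ) :=
  (integrable_inner_isoGaussian hσ u).mul_bdd (c := 1) (by fun_prop)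
    (ae_of_all _ fun x => Real.abs_sin_le_one _)

lemma integral_inner_mul_sin_isoGaussian {d : ℕ} {σ : ℝ} (hσ : 0 < σ)
    (θ : EuclideanSpace ℝ (Fin d)) {e : EuclideanSpace ℝ (Fin d)} (he : ‖e‖ = 1) (ℓ : ℝ) :
    ∫ x, ⟪θ, x⟫ * Real.sin (ℓ * ⟪e, x⟫) ∂(isoGaussian d σ) =
      ⟪θ, e⟫ * (ℓ / σ ^ 2 * Real.exp (-(ℓ ^ 2 / (2 * σ ^ 2)))) := by
  have := isProbabilityMeasure_isoGaussian d hσ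
  have := isNegInvariant_isoGaussian (d := d) hσ
  set w := θ - ⟪θ, e⟫ • e with hw
  have hwe : ⟪w, e⟫ = 0 := by
    rw [hw, inner_sub_left, inner_smul_left, real_inner_self_eq_norm_sq, he]; simp
  have hx (x) : ⟪θ, x⟫ * Real.sin (ℓ * ⟪e, x⟫) =
      ⟪θ, e⟫ * (⟪e, x⟫ * Real.sin (ℓ * ⟪e, x⟫)) + ⟪w, x⟫ * Real.sin (ℓ * ⟪e, x⟫) := by
    rw [hw, inner_sub_left, inner_smul_left]; simp; ring
  have h1 : ∫ x, ⟪e, x⟫ * Real.sin (ℓ * ⟪e, x⟫) ∂(isoGaussian d σ) =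
      ℓ / σ ^ 2 * Real.exp (-(ℓ ^ 2 / (2 * σ ^ 2))) := by
    have h := integral_map (μ := isoGaussian d σ) (φ := fun x => ⟪e, x⟫) (by fun_prop)
      (f := fun t => t * Real.sin (ℓ * t)) (by fun_prop)
    rw [← h, map_inner_isoGaussian hσ, integral_mul_sin_gaussianReal]
    push_cast [Real.coe_toNNReal _ hσ.le, he, coe_nnnorm]
    rw [one_pow, show -(1 / σ ^ 2 * ℓ ^ 2 / 2) = -(ℓ ^ 2 / (2 * σ ^ 2)) by field_simp]
    ring
  -- The component along `w ⟂ e` is centered and independent of the sine.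
  have h2 : ∫ x, ⟪w, x⟫ * Real.sin (ℓ * ⟪e, x⟫) ∂(isoGaussian d σ) = 0 := by
    have hind : IndepFun (fun x => ⟪w, x⟫) (fun x => Real.sin (ℓ * ⟪e, x⟫)) (isoGaussian d σ) :=
      (indepFun_inner_isoGaussian hσ hwe).comp (φ := id) (ψ := fun t => Real.sin (ℓ * t))
        (by fun_prop) (by fun_prop)
    rw [hind.integral_fun_mul_eq_mul_integral (by fun_prop) (by fun_prop)]
    have : ∫ x, ⟪w, x⟫ ∂(isoGaussian d σ) = 0 := by
      refine self_eq_neg.1 ?_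
      rw [← integral_neg, ← integral_neg_eq_self]
      simp
    rw [this, zero_mul]
  simp_rw [hx]
  rw [integral_add ((integrable_inner_mul_sin_isoGaussian hσ e e ℓ).const_mul _)
    (integrable_inner_mul_sin_isoGaussian hσ w e ℓ), integral_const_mul, h1, h2, add_zero]

/-- Separates the even and odd parts. For `-1 ≤ c ≤ 0` the coefficients lie in `[0, 1/2]` and `[1/2,
1]`, so the later bounds do not depend on `c`. -/
lemma act_eq (c t : ℝ) : act c t = (1 + c) / 2 * |t| + (1 - c) / 2 * t := by
  unfold act
  rcases le_total 0 t with h | h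
  · rw [max_eq_left h, max_eq_right (by linarith), abs_of_nonneg h]; ring
  · rw [max_eq_right h, max_eq_left (by linarith), abs_of_nonpos h]; ring

lemma abs_integral_act_mul_sin_le {d : ℕ} {σ : ℝ} (hσ : 0 < σ)
    {θ e : EuclideanSpace ℝ (Fin d)} (hθ : ‖θ‖ = 1) (he : ‖e‖ = 1) {ℓ c : ℝ} (hℓ : 0 ≤ ℓ)
    (hc : -1 ≤ c) (hc' : c ≤ 0) (b : ℝ) :
    |∫ x, act c (⟪θ, x⟫ - b) * Real.sin (ℓ * ⟪e, x⟫) ∂(isoGaussian d σ)| ≤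
      1 / 2 * (|b| * Real.exp (-(ℓ ^ 2 * (1 - ⟪θ, e⟫ ^ 2) / (2 * σ ^ 2)))) +
        ℓ / σ ^ 2 * Real.exp (-(ℓ ^ 2 / (2 * σ ^ 2))) := by
  have := isProbabilityMeasure_isoGaussian d hσ
  have := isNegInvariant_isoGaussian (d := d) hσ
  set s := fun x : EuclideanSpace ℝ (Fin d) => Real.sin (ℓ * ⟪e, x⟫) with hs
  have hsc : Continuous s := by fun_prop
  have hs1 (x) : |s x| ≤ 1 := Real.abs_sin_le_one _
  -- The Gaussian is symmetric and the sine is odd. This removes both `|⟪θ, x⟫|` and the constant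
  -- `b`.
  have hodd (F : EuclideanSpace ℝ (Fin d) → ℝ) (hF : ∀ x, F (-x) = F x) :
      ∫ x, F x * s x ∂(isoGaussian d σ) = 0 := by
    refine self_eq_neg.1 ?_
    rw [← integral_neg, ← integral_neg_eq_self]
    simp [hs, hF]
  -- Subtracting `|t|`, whose contribution vanishes, turns the unbounded `|t - b|` into a function
  -- bounded by `|b|`.
  have hdiff (t : ℝ) : |(|t - b| - |t|)| ≤ |b| := by
    have := abs_abs_sub_abs_le_abs_sub (t - b) t
    simpa using this
  have i1 : Integrable (fun x => (|⟪θ, x⟫ - b| - |⟪θ, x⟫|) * s x) (isoGaussian d σ) := by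
    refine (integrable_const |b|).mono' (by fun_prop) (ae_of_all _ fun x => ?_)
    rw [Real.norm_eq_abs, abs_mul]
    exact (mul_le_mul (hdiff _) (hs1 x) (abs_nonneg _) (abs_nonneg _)).trans_eq (mul_one _)
  have i2 : Integrable (fun x => |⟪θ, x⟫| * s x) (isoGaussian d σ) :=
    (integrable_inner_isoGaussian hσ θ).abs.mul_bdd (c := 1) (by fun_prop) (ae_of_all _ hs1)
  have i3 := integrable_inner_mul_sin_isoGaussian hσ θ e ℓ
  have i4 : Integrable (fun x => b * s x) (isoGaussian d σ) :=
    (integrable_const b).mul_bdd (c := 1) (by fun_prop) (ae_of_all _ hs1)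
  have i12 : Integrable (fun x => (1 + c) / 2 * ((|⟪θ, x⟫ - b| - |⟪θ, x⟫|) * s x +
      |⟪θ, x⟫| * s x)) (isoGaussian d σ) := (i1.add i2).const_mul _
  have i34 : Integrable (fun x => (1 - c) / 2 * (⟪θ, x⟫ * s x - b * s x)) (isoGaussian d σ) :=
    (i3.sub i4).const_mul _
  have hdec (x) : act c (⟪θ, x⟫ - b) * s x =
      (1 + c) / 2 * ((|⟪θ, x⟫ - b| - |⟪θ, x⟫|) * s x + |⟪θ, x⟫| * s x) +
        (1 - c) / 2 * (⟪θ, x⟫ * s x - b * s x) := by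
    rw [act_eq]; ring
  have hsplit : ∫ x, act c (⟪θ, x⟫ - b) * s x ∂(isoGaussian d σ) =
      (1 + c) / 2 * ∫ x, (|⟪θ, x⟫ - b| - |⟪θ, x⟫|) * s x ∂(isoGaussian d σ) +
        (1 - c) / 2 * (⟪θ, e⟫ * (ℓ / σ ^ 2 * Real.exp (-(ℓ ^ 2 / (2 * σ ^ 2))))) := by
    simp_rw [hdec]
    rw [integral_add i12 i34, integral_const_mul,
      integral_const_mul, integral_add i1 i2, integral_sub i3 i4, hodd (fun x => |⟪θ, x⟫|) (by simp),
      hodd (fun _ => b) (by simp), integral_inner_mul_sin_isoGaussian hσ θ he, add_zero, sub_zero]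
  have hθe : |⟪θ, e⟫| ≤ 1 := by
    simpa [hθ, he] using abs_real_inner_le_norm θ e
  have hA := abs_integral_comp_inner_mul_sin_le hσ hθ he ℓ (g := fun t => |t - b| - |t|)
    (by fun_prop) hdiff
  have hB : 0 ≤ ℓ / σ ^ 2 * Real.exp (-(ℓ ^ 2 / (2 * σ ^ 2))) := by positivity
  rw [hsplit]
  refine (abs_add_le _ _).trans (add_le_add ?_ ?_)
  · rw [abs_mul, abs_of_nonneg (show 0 ≤ (1 + c) / 2 by linarith)]
    exact mul_le_mul (by linarith) hA (abs_nonneg _) (by norm_num)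
  · rw [abs_mul, abs_mul ⟪θ, e⟫, abs_of_nonneg hB,
      abs_of_nonneg (show 0 ≤ (1 - c) / 2 by linarith), ← mul_assoc]
    refine mul_le_of_le_one_left hB ?_
    exact mul_le_one₀ (by linarith) (abs_nonneg _) hθe

end ReluMMD

/-! ### The RKHS: kernel sections, Bochner integrals and the feature representation. -/

namespace ReluMMD

open scoped RealInnerProductSpace

section RKHS

variable {d : ℕ} {c : ℝ}

lemma abs_act_sub_act_le (hc : -1 ≤ c) (hc' : c ≤ 0) (s t : ℝ) :
    |act c s - act c t| ≤ |s - t| := by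
  wlog h : t ≤ s generalizing s t
  · rw [abs_sub_comm, abs_sub_comm s]
    exact this t s (not_le.1 h).le
  rw [abs_of_nonneg (sub_nonneg.2 h), abs_le]
  unfold act
  rcases max_cases s 0 with ⟨h1, h1'⟩ | ⟨h1, h1'⟩ <;>
  rcases max_cases t 0 with ⟨h2, h2'⟩ | ⟨h2, h2'⟩ <;>
  rcases max_cases (-s) 0 with ⟨h3, h3'⟩ | ⟨h3, h3'⟩ <;>
  rcases max_cases (-t) 0 with ⟨h4, h4'⟩ | ⟨h4, h4'⟩ <;>
  rw [h1, h2, h3, h4] <;> constructor <;> nlinarith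

lemma abs_feature_sub_feature_le (hc : -1 ≤ c) (hc' : c ≤ 0) (x y : EuclideanSpace ℝ (Fin d))
    (p : Metric.sphere (0 : EuclideanSpace ℝ (Fin d)) 1 × ℝ) :
    |feature d c x p - feature d c y p| ≤ ‖x - y‖ := by
  refine (abs_act_sub_act_le hc hc' _ _).trans ?_
  rw [sub_sub_sub_cancel_right, ← inner_sub_right]
  simpa using abs_real_inner_le_norm (p.1 : EuclideanSpace ℝ (Fin d)) (x - y)

lemma abs_feature_le (hc : -1 ≤ c) (hc' : c ≤ 0) (x : EuclideanSpace ℝ (Fin d))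
    (p : Metric.sphere (0 : EuclideanSpace ℝ (Fin d)) 1 × ℝ) :
    |feature d c x p| ≤ ‖x‖ + |p.2| := by
  have h := abs_act_sub_act_le hc hc' (⟪(p.1 : EuclideanSpace ℝ (Fin d)), x⟫ - p.2) 0
  have h0 : act c 0 = 0 := by simp [act]
  rw [h0, sub_zero, sub_zero] at h
  refine h.trans ((abs_sub _ _).trans ?_)
  gcongr
  simpa using abs_real_inner_le_norm (p.1 : EuclideanSpace ℝ (Fin d)) x

lemma continuous_uncurry_feature (d : ℕ) (c : ℝ) :
    Continuous fun q : EuclideanSpace ℝ (Fin d) ×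
      (Metric.sphere (0 : EuclideanSpace ℝ (Fin d)) 1 × ℝ) => feature d c q.1 q.2 := by
  unfold feature act; fun_prop

lemma integrable_feature_mul (x y : EuclideanSpace ℝ (Fin d)) :
    Integrable (fun p => feature d c x p * feature d c y p) (featureLaw d) :=
  (memLp_feature d c x).integrable_mul (memLp_feature d c y)

/-- The kernel section `k(x, ·)`, as an element of the reproducing kernel Hilbert space. -/
noncomputable def kernelSection (d : ℕ) (c : ℝ) (x : EuclideanSpace ℝ (Fin d)) :
    RKHS.OfKernel (kernelMatrix d c) :=
  RKHS.kerFun (RKHS.OfKernel (kernelMatrix d c)) x 1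

lemma inner_kernelSection (f : RKHS.OfKernel (kernelMatrix d c)) (x : EuclideanSpace ℝ (Fin d)) :
    ⟪f, kernelSection d c x⟫ = f x := by
  rw [kernelSection, RKHS.inner_kerFun]; simp

lemma kernelSection_apply (x y : EuclideanSpace ℝ (Fin d)) :
    kernelSection d c x y = nnKernel d c y x := by
  rw [kernelSection, RKHS.kerFun_apply, RKHS.OfKernel.kernel_ofKernel]
  simp [kernelMatrix]

/-- The squared distance of two sections is the `L²(τ)` distance squared of the features, which are
1-Lipschitz in `x` because the activation is. Continuity and linear growth of the sections, hence
their Bochner integrability, follow. -/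
lemma norm_kernelSection_sub_le (hc : -1 ≤ c) (hc' : c ≤ 0) [NeZero d]
    (x y : EuclideanSpace ℝ (Fin d)) :
    ‖kernelSection d c x - kernelSection d c y‖ ≤ ‖x - y‖ := by
  have := isProbabilityMeasure_sphereUnif d
  have : IsProbabilityMeasure (featureLaw d) := by unfold featureLaw; infer_instance
  refine le_of_sq_le_sq ?_ (norm_nonneg _)
  have hsq : ‖kernelSection d c x - kernelSection d c y‖ ^ 2 =
      ∫ p, (feature d c x p - feature d c y p) ^ 2 ∂(featureLaw d) := by
    have hsymm : nnKernel d c y x = nnKernel d c x y := by simp only [nnKernel, mul_comm]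
    rw [norm_sub_sq_real, ← real_inner_self_eq_norm_sq, ← real_inner_self_eq_norm_sq]
    simp only [inner_kernelSection, kernelSection_apply, hsymm]
    have e (p) : (feature d c x p - feature d c y p) ^ 2 =
        feature d c x p * feature d c x p - 2 * (feature d c x p * feature d c y p) +
          feature d c y p * feature d c y p := by ring
    simp_rw [e]
    rw [integral_add _ (integrable_feature_mul y y), integral_sub (integrable_feature_mul x x)
      ((integrable_feature_mul x y).const_mul _), integral_const_mul]
    · rfl
    · exact (integrable_feature_mul x x).sub ((integrable_feature_mul x y).const_mul _)
  rw [hsq]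
  calc _ ≤ ∫ p, ‖x - y‖ ^ 2 ∂(featureLaw d) := by
        refine integral_mono_of_nonneg (ae_of_all _ fun p => sq_nonneg _) (integrable_const _)
          (ae_of_all _ fun p => ?_)
        exact sq_le_sq.2 (by simpa using abs_feature_sub_feature_le hc hc' x y p)
    _ = _ := by simp

lemma continuous_kernelSection (hc : -1 ≤ c) (hc' : c ≤ 0) [NeZero d] :
    Continuous (kernelSection d c) :=
  (LipschitzWith.of_dist_le_mul (K := 1) fun x y => by
    simpa [dist_eq_norm] using norm_kernelSection_sub_le hc hc' x y).continuous

lemma integrable_kernelSection (hc : -1 ≤ c) (hc' : c ≤ 0) [NeZero d]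
    {γ : Measure (EuclideanSpace ℝ (Fin d))} [IsFiniteMeasure γ] (hγ : Integrable (‖·‖) γ) :
    Integrable (kernelSection d c) γ := by
  refine ((integrable_const ‖kernelSection d c 0‖).add hγ).mono'
    (continuous_kernelSection hc hc').aestronglyMeasurable (ae_of_all _ fun x => ?_)
  have h := norm_kernelSection_sub_le hc hc' x 0
  rw [sub_zero] at h
  exact (norm_le_norm_add_norm_sub' _ _).trans (add_le_add le_rfl h)

lemma integrable_coe_rkhs (hc : -1 ≤ c) (hc' : c ≤ 0) [NeZero d]
    {γ : Measure (EuclideanSpace ℝ (Fin d))} [IsFiniteMeasure γ] (hγ : Integrable (‖·‖) γ)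
    (f : RKHS.OfKernel (kernelMatrix d c)) : Integrable f γ := by
  have h : (f : EuclideanSpace ℝ (Fin d) → ℝ) = fun x => ⟪f, kernelSection d c x⟫ :=
    funext fun x => (inner_kernelSection f x).symm
  rw [h]
  exact (integrable_kernelSection hc hc' hγ).const_inner f

lemma integrable_bias_mul (d : ℕ) (m : ℝ) :
    Integrable (fun p : Metric.sphere (0 : EuclideanSpace ℝ (Fin d)) 1 × ℝ =>
      (1 + |p.2|) * (m + |p.2|)) (featureLaw d) := by
  have h1 : MemLp (fun p : Metric.sphere (0 : EuclideanSpace ℝ (Fin d)) 1 × ℝ => |p.2|) 2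
      (featureLaw d) :=
    ((memLp_id_gaussianReal (μ := 0) (v := 1) 2).comp_snd (sphereUnif d)).norm
  exact ((memLp_const (1 : ℝ)).add h1).integrable_mul ((memLp_const m).add h1)

/-- The test function `h` is kept general because Fubini is applied twice: with `h` a feature and
with `h` an integrated feature. Both grow at most like `m + |b|`. -/
lemma integrable_feature_mul_prod (hc : -1 ≤ c) (hc' : c ≤ 0)
    {γ : Measure (EuclideanSpace ℝ (Fin d))} [IsFiniteMeasure γ] (hγ : Integrable (‖·‖) γ)
    {w : EuclideanSpace ℝ (Fin d) → ℝ} (hw : Measurable w) (hw1 : ∀ x, |w x| ≤ 1)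
    {h : Metric.sphere (0 : EuclideanSpace ℝ (Fin d)) 1 × ℝ → ℝ} (hh : StronglyMeasurable h)
    {m : ℝ} (hm : ∀ p, |h p| ≤ m + |p.2|) :
    Integrable (fun q : EuclideanSpace ℝ (Fin d) ×
      (Metric.sphere (0 : EuclideanSpace ℝ (Fin d)) 1 × ℝ) =>
      w q.1 * (feature d c q.1 q.2 * h q.2)) (γ.prod (featureLaw d)) := by
  refine (((integrable_const (1 : ℝ)).add hγ).mul_prod (integrable_bias_mul d m)).mono' ?_
    (ae_of_all _ fun q => ?_)
  · have := continuous_uncurry_feature d c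
    have := hh.measurable
    exact Measurable.aestronglyMeasurable (by fun_prop)
  · rw [Real.norm_eq_abs, abs_mul, abs_mul]
    have h1 := abs_feature_le hc hc' q.1 q.2
    have h2 : ‖q.1‖ + |q.2.2| ≤ (1 + ‖q.1‖) * (1 + |q.2.2|) := by
      nlinarith [norm_nonneg q.1, abs_nonneg q.2.2, mul_nonneg (norm_nonneg q.1) (abs_nonneg q.2.2)]
    calc |w q.1| * (|feature d c q.1 q.2| * |h q.2|)
        ≤ 1 * (((1 + ‖q.1‖) * (1 + |q.2.2|)) * (m + |q.2.2|)) := by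
          gcongr
          · exact hw1 _
          · exact h1.trans h2
          · exact hm _
      _ = _ := by simp only [Pi.add_apply]; ring

/-- Fubini for the weighted features, tested against a function `h` of the parameters. -/
lemma integral_mul_integral_feature_mul (hc : -1 ≤ c) (hc' : c ≤ 0)
    {γ : Measure (EuclideanSpace ℝ (Fin d))} [IsFiniteMeasure γ] (hγ : Integrable (‖·‖) γ)
    {w : EuclideanSpace ℝ (Fin d) → ℝ} (hw : Measurable w) (hw1 : ∀ x, |w x| ≤ 1)
    {h : Metric.sphere (0 : EuclideanSpace ℝ (Fin d)) 1 × ℝ → ℝ} (hh : StronglyMeasurable h)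
    {m : ℝ} (hm : ∀ p, |h p| ≤ m + |p.2|) :
    ∫ x, w x * ∫ p, feature d c x p * h p ∂(featureLaw d) ∂γ =
      ∫ p, (∫ x, feature d c x p * w x ∂γ) * h p ∂(featureLaw d) := by
  simp_rw [← integral_const_mul, ← integral_mul_const]
  rw [integral_integral_swap (integrable_feature_mul_prod hc hc' hγ hw hw1 hh hm)]
  congr 1; ext p; congr 1; ext x; ring

/-- The integral of an RKHS function against a weight is controlled by the `L²` norm of the
integrated features. -/
lemma sq_integral_rkhs_mul_le (hc : -1 ≤ c) (hc' : c ≤ 0) [NeZero d]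
    {γ : Measure (EuclideanSpace ℝ (Fin d))} [IsProbabilityMeasure γ] (hγ : Integrable (‖·‖) γ)
    {w : EuclideanSpace ℝ (Fin d) → ℝ} (hw : Measurable w) (hw1 : ∀ x, |w x| ≤ 1)
    (f : RKHS.OfKernel (kernelMatrix d c)) :
    (∫ x, w x * f x ∂γ) ^ 2 ≤
      ‖f‖ ^ 2 * ∫ p, (∫ x, feature d c x p * w x ∂γ) ^ 2 ∂(featureLaw d) := by
  -- `v` is the Riesz representer of `f ↦ ∫ w f dγ`; the claim is Cauchy–Schwarz once `‖v‖²` is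
  -- computed.
  set v : RKHS.OfKernel (kernelMatrix d c) := ∫ x, w x • kernelSection d c x ∂γ with hv
  have hi : Integrable (fun x => w x • kernelSection d c x) γ :=
    (integrable_kernelSection hc hc' hγ).bdd_smul 1 hw.aestronglyMeasurable (ae_of_all _ hw1)
  have hinner (g : RKHS.OfKernel (kernelMatrix d c)) : ⟪g, v⟫ = ∫ x, w x * g x ∂γ := by
    rw [hv, ← integral_inner hi]
    simp only [inner_smul_right, inner_kernelSection]
  set G := fun p => ∫ x, feature d c x p * w x ∂γ with hG
  have hGm : StronglyMeasurable G := by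
    have := continuous_uncurry_feature d c
    have hm : Measurable fun q : (Metric.sphere (0 : EuclideanSpace ℝ (Fin d)) 1 × ℝ) ×
        EuclideanSpace ℝ (Fin d) => feature d c q.2 q.1 * w q.2 :=
      (this.measurable.comp measurable_swap).mul (hw.comp measurable_snd)
    exact hm.stronglyMeasurable.integral_prod_right
  have hGb (p) : |G p| ≤ (∫ x, ‖x‖ ∂γ) + |p.2| := by
    have h1 : Integrable (fun x => ‖x‖ + |p.2|) γ := hγ.add (integrable_const _)
    rw [← Real.norm_eq_abs]
    refine (norm_integral_le_of_norm_le h1 (ae_of_all _ fun x => ?_)).trans_eq ?_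
    · rw [Real.norm_eq_abs, abs_mul]
      exact (mul_le_of_le_one_right (abs_nonneg _) (hw1 x)).trans (abs_feature_le hc hc' x p)
    · rw [integral_add hγ (integrable_const _)]; simp
  have hvx (x) : v x = ∫ p, feature d c x p * G p ∂(featureLaw d) := by
    rw [← inner_kernelSection, real_inner_comm, hinner]
    simp only [kernelSection_apply, nnKernel]
    rw [integral_mul_integral_feature_mul hc hc' hγ hw hw1
      (continuous_feature d c x).stronglyMeasurable (abs_feature_le hc hc' x)]
    simp only [mul_comm, hG]
  -- Here `‖v‖² = ⟪v, v⟫ = ∫ w v dγ`; inserting the feature formula for `v` and swapping the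
  -- integrals produces a second factor `G`.
  have hvv : ‖v‖ ^ 2 = ∫ p, G p ^ 2 ∂(featureLaw d) := by
    rw [← real_inner_self_eq_norm_sq, hinner]
    simp_rw [hvx]
    rw [integral_mul_integral_feature_mul hc hc' hγ hw hw1 hGm hGb]
    simp only [sq, hG]
  rw [← hinner, ← hvv, ← mul_pow, ← sq_abs]
  gcongr
  exact abs_real_inner_le_norm _ _

end RKHS

end ReluMMD

/-! ### The signed measure `μ - ν` and the assembly of the bound. -/

namespace ReluMMD

open scoped RealInnerProductSpace

lemma rho_eq {d : ℕ} [NeZero d] (σ ℓ : ℝ) (x : EuclideanSpace ℝ (Fin d)) :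
    rho d σ ℓ x = 2 * (isoGaussianPDF d σ x * Real.sin (ℓ * x 0)) := by
  unfold rho isoGaussianPDF; ring

@[fun_prop]
lemma continuous_rho (d : ℕ) [NeZero d] (σ ℓ : ℝ) : Continuous (rho d σ ℓ) := by
  unfold rho; fun_prop

lemma abs_rho_le {d : ℕ} [NeZero d] {σ : ℝ} (hσ : 0 < σ) (ℓ : ℝ) (x : EuclideanSpace ℝ (Fin d)) :
    |rho d σ ℓ x| ≤ 2 * isoGaussianPDF d σ x := by
  rw [rho_eq, abs_mul, abs_mul, abs_of_nonneg (isoGaussianPDF_nonneg hσ x), abs_two]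
  gcongr
  exact mul_le_of_le_one_right (isoGaussianPDF_nonneg hσ x) (Real.abs_sin_le_one _)

/-- Subtraction of measures and `ENNReal.ofReal` both truncate at zero, so the difference has the
positive part of `p - q` as density. -/
lemma withDensity_ofReal_sub {X : Type*} [MeasurableSpace X] {m : Measure X} {p q r : X → ℝ}
    (hp : Measurable p) (hq : Measurable q) (hq0 : ∀ x, 0 ≤ q x) (h : ∀ᵐ x ∂m, p x - q x = r x)
    [IsFiniteMeasure (m.withDensity fun x => ENNReal.ofReal (q x))] :
    m.withDensity (fun x => ENNReal.ofReal (p x)) - m.withDensity (fun x => ENNReal.ofReal (q x)) =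
      m.withDensity fun x => ENNReal.ofReal (r x) := by
  rw [← Measure.withDensity_sub (by fun_prop) (by fun_prop)]
  refine withDensity_congr_ae (h.mono fun x hx => ?_)
  change ENNReal.ofReal (p x) - ENNReal.ofReal (q x) = ENNReal.ofReal (r x)
  rw [← hx, ENNReal.ofReal_sub _ (hq0 x)]

lemma withDensity_le_isoGaussian {d : ℕ} {σ : ℝ} {r : EuclideanSpace ℝ (Fin d) → ℝ}
    (hr : ∀ x, r x ≤ 2 * isoGaussianPDF d σ x) :
    (volume.withDensity fun x => ENNReal.ofReal (r x)) ≤ (2 : ℝ≥0∞) • isoGaussian d σ := by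
  rw [isoGaussian, ← withDensity_smul _ (by fun_prop)]
  refine withDensity_mono (ae_of_all _ fun x => ?_)
  refine (ENNReal.ofReal_le_ofReal (hr x)).trans_eq ?_
  rw [ENNReal.ofReal_mul (by norm_num)]
  simp

section Pair

variable {d : ℕ} [NeZero d] {σ ℓ : ℝ} {μ ν : Measure (EuclideanSpace ℝ (Fin d))}

lemma IsPair.sub_eq (h : IsPair d σ ℓ μ ν) :
    μ - ν = volume.withDensity fun x => ENNReal.ofReal (rho d σ ℓ x) := by
  obtain ⟨_, _, p, q, hp, hq, -, hq0, rfl, rfl, hpq⟩ := h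
  exact withDensity_ofReal_sub hp hq hq0 hpq

lemma IsPair.sub_eq' (h : IsPair d σ ℓ μ ν) :
    ν - μ = volume.withDensity fun x => ENNReal.ofReal (-rho d σ ℓ x) := by
  obtain ⟨_, _, p, q, hp, hq, hp0, -, rfl, rfl, hpq⟩ := h
  exact withDensity_ofReal_sub hq hp hp0 (hpq.mono fun x hx => by rw [← hx]; ring)

/-- Both parts of the signed measure are dominated by twice the Gaussian, so no moments of `μ` or
`ν` themselves are required. -/
lemma IsPair.integrable (hσ : 0 < σ) (h : IsPair d σ ℓ μ ν) {f : EuclideanSpace ℝ (Fin d) → ℝ}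
    (hf : Integrable f (isoGaussian d σ)) : Integrable f (μ - ν) ∧ Integrable f (ν - μ) := by
  have hf2 : Integrable f ((2 : ℝ≥0∞) • isoGaussian d σ) := hf.smul_measure (by simp)
  rw [h.sub_eq, h.sub_eq']
  exact ⟨hf2.mono_measure (withDensity_le_isoGaussian fun x =>
      (le_abs_self _).trans (abs_rho_le hσ ℓ x)),
    hf2.mono_measure (withDensity_le_isoGaussian fun x =>
      (neg_le_abs _).trans (abs_rho_le hσ ℓ x))⟩

lemma IsPair.meanDiff_eq (hσ : 0 < σ) (h : IsPair d σ ℓ μ ν) {f : EuclideanSpace ℝ (Fin d) → ℝ}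
    (hf : Integrable f (isoGaussian d σ)) :
    meanDiff μ ν f = 2 * ∫ x, Real.sin (ℓ * x 0) * f x ∂(isoGaussian d σ) := by
  obtain ⟨h1, h2⟩ := h.integrable hσ hf
  rw [meanDiff]
  rw [h.sub_eq] at h1 ⊢
  rw [h.sub_eq'] at h2 ⊢
  have hm1 : Measurable fun x => ENNReal.ofReal (rho d σ ℓ x) := by fun_prop
  have hm2 : Measurable fun x => ENNReal.ofReal (-rho d σ ℓ x) := by fun_prop
  rw [integrable_withDensity_iff_integrable_smul' hm1 (by simp)] at h1
  rw [integrable_withDensity_iff_integrable_smul' hm2 (by simp)] at h2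
  rw [integral_withDensity_eq_integral_toReal_smul hm1 (by simp),
    integral_withDensity_eq_integral_toReal_smul hm2 (by simp), ← integral_sub h1 h2,
    integral_isoGaussian hσ, ← integral_const_mul]
  refine integral_congr_ae (ae_of_all _ fun x => ?_)
  simp only [smul_eq_mul, ENNReal.toReal_ofReal']
  rw [← sub_mul, max_zero_sub_max_neg_zero_eq_self, rho_eq]
  ring

end Pair

lemma integral_sq_feature_sin_le {d : ℕ} [NeZero d] {σ ℓ c : ℝ} (hσ : 0 < σ) (hℓ : 0 ≤ ℓ)
    (hc : -1 ≤ c) (hc' : c ≤ 0) :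
    ∫ p, (∫ x, feature d c x p * Real.sin (ℓ * x 0) ∂(isoGaussian d σ)) ^ 2 ∂(featureLaw d) ≤
      1 / 2 * (Real.exp (-(ℓ ^ 2 / (2 * σ ^ 2))) + 2 * (√2 / 2) ^ d) +
        2 * (ℓ / σ ^ 2 * Real.exp (-(ℓ ^ 2 / (2 * σ ^ 2)))) ^ 2 := by
  have := isProbabilityMeasure_sphereUnif d
  set e : EuclideanSpace ℝ (Fin d) := EuclideanSpace.single 0 1 with he
  have hen : ‖e‖ = 1 := by simp [he]
  have hex (x : EuclideanSpace ℝ (Fin d)) : x 0 = ⟪e, x⟫ := by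
    simp [he, EuclideanSpace.inner_single_left]
  set B := ℓ / σ ^ 2 * Real.exp (-(ℓ ^ 2 / (2 * σ ^ 2))) with hB
  set L := fun θ : Metric.sphere (0 : EuclideanSpace ℝ (Fin d)) 1 =>
    Real.exp (-(ℓ ^ 2 / σ ^ 2 * (1 - ⟪(θ : EuclideanSpace ℝ (Fin d)), e⟫ ^ 2))) with hL
  have hb2 : Integrable (fun b : ℝ => b ^ 2) (gaussianReal 0 1) :=
    (memLp_id_gaussianReal (μ := 0) (v := 1) 2).integrable_sq
  have hLi : Integrable L (sphereUnif d) := by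
    have hcont : Continuous L := by fun_prop
    exact hcont.integrable_of_hasCompactSupport (HasCompactSupport.of_compactSpace _)
  have hi : Integrable (fun p : Metric.sphere (0 : EuclideanSpace ℝ (Fin d)) 1 × ℝ =>
      L p.1 * p.2 ^ 2) (featureLaw d) := hLi.mul_prod hb2
  -- This is `(s + t)² ≤ 2s² + 2t²` with `s = |b| E / 2` and `t = B`, where `E² = L θ`.
  have hpt (p : Metric.sphere (0 : EuclideanSpace ℝ (Fin d)) 1 × ℝ) :
      (∫ x, feature d c x p * Real.sin (ℓ * x 0) ∂(isoGaussian d σ)) ^ 2 ≤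
        1 / 2 * (L p.1 * p.2 ^ 2) + 2 * B ^ 2 := by
    have h := abs_integral_act_mul_sin_le hσ (θ := p.1) (by simp) hen hℓ hc hc' p.2
    simp_rw [hex]
    set E := Real.exp (-(ℓ ^ 2 * (1 - ⟪(p.1 : EuclideanSpace ℝ (Fin d)), e⟫ ^ 2) / (2 * σ ^ 2)))
      with hE
    have hEL : L p.1 = E ^ 2 := by
      rw [hL, hE, ← Real.exp_nat_mul]
      push_cast
      field_simp
    have hsq := pow_le_pow_left₀ (abs_nonneg _) h 2
    rw [sq_abs] at hsq
    refine hsq.trans ?_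
    rw [hEL, ← sq_abs p.2]
    nlinarith [sq_nonneg (1 / 2 * (|p.2| * E) - B)]
  calc _ ≤ ∫ p, (1 / 2 * (L p.1 * p.2 ^ 2) + 2 * B ^ 2) ∂(featureLaw d) :=
        integral_mono_of_nonneg (ae_of_all _ fun p => sq_nonneg _)
          ((hi.const_mul _).add (integrable_const _)) (ae_of_all _ hpt)
    _ = 1 / 2 * ∫ θ, L θ ∂(sphereUnif d) + 2 * B ^ 2 := by
        have hvar : ∫ b, b ^ 2 ∂(gaussianReal 0 1) = 1 := by
          have h := variance_fun_id_gaussianReal (μ := 0) (v := 1)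
          rw [variance_of_integral_eq_zero (by fun_prop) (by simp)] at h
          simpa using h
        have : IsProbabilityMeasure (featureLaw d) := by unfold featureLaw; infer_instance
        rw [integral_add (hi.const_mul _) (integrable_const _), integral_const_mul, featureLaw,
          integral_prod_mul L (fun b => b ^ 2), hvar, mul_one]
        simp
    _ ≤ _ := by
        have h := integral_exp_sphereUnif_le d hen (a := ℓ ^ 2 / σ ^ 2) (by positivity)
        rw [show ℓ ^ 2 / σ ^ 2 / 2 = ℓ ^ 2 / (2 * σ ^ 2) by field_simp] at h
        gcongr

lemma IsPair.abs_meanDiff_le {d : ℕ} [NeZero d] {σ ℓ c : ℝ}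
    {μ ν : Measure (EuclideanSpace ℝ (Fin d))} (h : IsPair d σ ℓ μ ν) (hσ : 0 < σ) (hℓ : 0 ≤ ℓ)
    (hc : -1 ≤ c) (hc' : c ≤ 0) {f : RKHS.OfKernel (kernelMatrix d c)} (hf : ‖f‖ ≤ 1) :
    |meanDiff μ ν f| ≤ 3 * (((2 : ℝ) ^ (-(d : ℝ) / 4) + Real.exp (-ℓ ^ 2 / (4 * σ ^ 2))) +
      ℓ / σ ^ 2 * Real.exp (-ℓ ^ 2 / (2 * σ ^ 2))) := by
  have := isProbabilityMeasure_isoGaussian d hσ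
  have hγ := integrable_norm_isoGaussian (d := d) hσ
  set P := (2 : ℝ) ^ (-(d : ℝ) / 4) with hP
  set q := Real.exp (-ℓ ^ 2 / (4 * σ ^ 2)) with hq
  set B := ℓ / σ ^ 2 * Real.exp (-ℓ ^ 2 / (2 * σ ^ 2)) with hB
  have hP2 : (√2 / 2) ^ d = P ^ 2 := by
    have h1 : √2 / 2 = (2 : ℝ) ^ (-(1 / 2) : ℝ) := by
      rw [Real.rpow_neg (by norm_num), ← Real.sqrt_eq_rpow, Real.sqrt_div_self', one_div]
    rw [h1, hP, ← Real.rpow_natCast, ← Real.rpow_natCast, ← Real.rpow_mul (by norm_num),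
      ← Real.rpow_mul (by norm_num)]
    congr 1
    push_cast; ring
  have hq2 : Real.exp (-(ℓ ^ 2 / (2 * σ ^ 2))) = q ^ 2 := by
    rw [hq, ← Real.exp_nat_mul]
    congr 1
    push_cast
    field_simp
    norm_num
  have hP0 : 0 ≤ P := by positivity
  have hq0 : 0 ≤ q := by positivity
  have hB0 : 0 ≤ B := by positivity
  have h1 := sq_integral_rkhs_mul_le hc hc' hγ (w := fun x => Real.sin (ℓ * x 0)) (by fun_prop)
    (fun x => Real.abs_sin_le_one _) f
  have h2 := integral_sq_feature_sin_le (d := d) hσ hℓ hc hc'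
  rw [hP2, ← neg_div, ← hB, neg_div, hq2] at h2
  have hf2 : ‖f‖ ^ 2 ≤ 1 := pow_le_one₀ (norm_nonneg _) hf
  have h3 := h1.trans (mul_le_of_le_one_left (integral_nonneg fun p => sq_nonneg _) hf2)
  rw [h.meanDiff_eq hσ (integrable_coe_rkhs hc hc' hγ f)]
  refine abs_le_of_sq_le_sq ?_ (by positivity)
  rw [mul_pow]
  -- The left side is at most `4 (½(q² + 2P²) + 2B²) = 2q² + 4P² + 8B²`, which is below `9 (P + q +
  -- B)²`; hence the constant 3.
  nlinarith [mul_nonneg hP0 hq0, mul_nonneg hP0 hB0, mul_nonneg hq0 hB0, sq_nonneg P, sq_nonneg q,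
    sq_nonneg B]

end ReluMMD

theorem mainTheorem4 :
    ∃ C : ℝ, 0 < C ∧
      ∀ (d : ℕ) [NeZero d] (σ ℓ c : ℝ), 0 < σ → 0 ≤ ℓ → -1 < c → c ≤ 0 →
        ∀ μ ν : Measure (EuclideanSpace ℝ (Fin d)), ReluMMD.IsPair d σ ℓ μ ν →
          (∀ f ∈ ReluMMD.rkhsUnitBall d c, Integrable f (μ - ν) ∧ Integrable f (ν - μ)) ∧
          ReluMMD.ipm (ReluMMD.rkhsUnitBall d c) μ ν ≤
            ENNReal.ofReal (C *
              ((d : ℝ) ^ (1 / 4 : ℝ) *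
                  ((2 : ℝ) ^ (-(d : ℝ) / 4) + Real.exp (-ℓ ^ 2 / (4 * σ ^ 2))) +
                ℓ ^ 2 / σ ^ 4 * Real.exp (-(ℓ - 1) ^ 2 / (2 * σ ^ 2)) +
                (ℓ / σ ^ 2 + 1) * Real.exp (-ℓ ^ 2 / (2 * σ ^ 2)))) := by
  refine ⟨3, by norm_num, fun d _ σ ℓ c hσ hℓ hc hc' μ ν h => ⟨?_, ?_⟩⟩
  · rintro _ ⟨f, -, rfl⟩
    have := ReluMMD.isProbabilityMeasure_isoGaussian d hσ
    exact h.integrable hσ (ReluMMD.integrable_coe_rkhs hc.le hc'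
      (ReluMMD.integrable_norm_isoGaussian hσ) f)
  · refine iSup₂_le fun _ hf => ENNReal.ofReal_le_ofReal ?_
    obtain ⟨f, hf, rfl⟩ := hf
    refine (h.abs_meanDiff_le hσ hℓ hc.le hc' hf).trans ?_
    -- The bound already obtained lacks the factor `d^(1/4) ≥ 1` and the remaining terms, which are
    -- nonnegative.
    have hd : (1 : ℝ) ≤ (d : ℝ) ^ (1 / 4 : ℝ) :=
      Real.one_le_rpow (by exact_mod_cast NeZero.one_le) (by norm_num)
    have h1 := le_mul_of_one_le_left (a := (d : ℝ) ^ (1 / 4 : ℝ))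
      (b := (2 : ℝ) ^ (-(d : ℝ) / 4) + Real.exp (-ℓ ^ 2 / (4 * σ ^ 2))) (by positivity) hd
    have h2 : 0 ≤ ℓ ^ 2 / σ ^ 4 * Real.exp (-(ℓ - 1) ^ 2 / (2 * σ ^ 2)) := by positivity
    have h3 := Real.exp_pos (-ℓ ^ 2 / (2 * σ ^ 2))
    linarith
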